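/- Let $n\ge 1$ and let $X$ be a random vector in $\mathbb R^n$ distributed according to a log-concave density $f$ with respect to Lebesgue measure, that is, $f\ge 0$ and $f(ax+by)\ge f(x)^a f(y)^b$ for all $x,y\in\mathbb R^n$ and $a,b>0$ with $a+b=1$. Then $f\log f$ is integrable (with $0\log 0=0$), so the entropy $h(X)=-\int_{\mathbb R^n} f(x)\log f(x)\,dx$ is finite, and for all $t>0$, $$\mathbb P\bigl\{\,|-\log f(X)-h(X)|\ge t\sqrt n\,\bigr\}\le 2e^{-ct},\qquad c=\tfrac1{16}.$$ Moreover, there is a universal constant $C>0$ (independent of $n$, $X$ and $f$) such that $$\|-\log f(X)-h(X)\|_{\psi_1}\le C\sqrt n,$$ where $\|Y\|_{\psi_1}=\inf\{\lambda>0:\ \mathbb E\,\psi_1(Y/\lambda)\le 1\}$ is the Orlicz norm generated by $\psi_1(t)=e^{|t|}-1$. -/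

import Mathlib

open MeasureTheory

noncomputable section

/-- A log-concave function: `f ≥ 0` and `f (a x + b y) ≥ f x ^ a * f y ^ b` for all convex weights.
Only positive weights occur, so that the convention `0 ^ 0 = 1` plays no role. -/
structure IsLogConcave {E : Type*} [AddCommGroup E] [Module ℝ E] (f : E → ℝ) : Prop where
  nonneg : ∀ x, 0 ≤ f x
  le_apply : ∀ (x y : E) (a b : ℝ), 0 < a → 0 < b → a + b = 1 →
    f x ^ a * f y ^ b ≤ f (a • x + b • y)

/-- The random vector `X` is distributed according to the density `f` with respect to Lebesgue
measure on `ℝⁿ`. -/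
structure HasLebesgueDensity {Ω : Type*} [MeasurableSpace Ω] (P : Measure Ω) {n : ℕ}
    (X : Ω → EuclideanSpace ℝ (Fin n)) (f : EuclideanSpace ℝ (Fin n) → ℝ) : Prop where
  aemeasurable : AEMeasurable X P
  aemeasurable_density : AEMeasurable f volume
  map_eq : P.map X = volume.withDensity (fun x => ENNReal.ofReal (f x))

/-- The information content `- log f(X)` of `X` with density `f`, as a random variable.
(The event `f(X) = 0` is null.) -/
def informationContent {Ω E : Type*} (X : Ω → E) (f : E → ℝ) (ω : Ω) : ℝ :=
  -Real.log (f (X ω))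

/-- The differential entropy `- ∫ f log f dx` of the density `f` (with `0 log 0 = 0`).
It is meaningful when `f log f` is integrable. -/
def differentialEntropy {n : ℕ} (f : EuclideanSpace ℝ (Fin n) → ℝ) : ℝ :=
  -∫ x, f x * Real.log (f x)

/-- The Young function `ψ₁(t) = e^{|t|} - 1`. -/
def psiOne (t : ℝ) : ℝ := Real.exp |t| - 1

/-- The Orlicz (Luxemburg) norm generated by a Young function `ψ`:
`inf {l > 0 : E ψ(Y / l) ≤ 1}`, equal to `∞` if there is no such `l`. -/
def orliczNorm {Ω : Type*} [MeasurableSpace Ω] (ψ : ℝ → ℝ) (P : Measure Ω) (Y : Ω → ℝ) : ENNReal :=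
  ⨅ (l : ℝ) (_ : 0 < l) (_ : ∫⁻ ω, ENNReal.ofReal (ψ (Y ω / l)) ∂P ≤ 1), ENNReal.ofReal l

end

/-! Everything follows from one convexity fact: for log-concave `f`, the function `p ↦ p ^ n * ∫ f ^
p` is log-concave on `p > 0`. After rescaling, `p ^ n * ∫ f ^ p` is the integral of `f (x / p) ^ p`,
and log-concavity of `f` is exactly the hypothesis of the Prékopa-Leindler inequality for these
functions.

The logarithm vanishes at `p = 1` with slope `n + E log f(X)`. Lying below its tangent there, with
`p = 1 + s`, means `E exp (s (log f(X) - E log f(X))) ≤ exp (n (s - log (1 + s)))`. The right side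
is at most `exp (2 n s ^ 2)` for `s ≥ -1/2`, so `s = ±1 / (2 √n)` bounds an exponential moment at
scale `√n` independently of `n`. Markov's inequality gives the tail, and the same moment gives the
`ψ₁` norm. -/

open scoped ENNReal Pointwise

/-! ### Brunn-Minkowski on the line -/

/-- The one-dimensional Brunn-Minkowski inequality for compact sets. -/
theorem volume_add_volume_le_of_isCompact {K L : Set ℝ} (hK : IsCompact K) (hL : IsCompact L)
    (hK0 : K.Nonempty) (hL0 : L.Nonempty) : volume K + volume L ≤ volume (K + L) := by
  -- With `k = max K` and `l = min L`, the translates `l + K` and `k + L` both lie in `K + L` and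
  -- meet at most in `k + l`.
  obtain ⟨k, hk, hkmax⟩ := hK.exists_isGreatest hK0
  obtain ⟨l, hl, hlmin⟩ := hL.exists_isLeast hL0
  have h1 : volume ((fun x => l + x) '' K) = volume K := by
    simp
  have h2 : volume ((fun x => k + x) '' L) = volume L := by
    simp
  have hd : AEDisjoint volume ((fun x => l + x) '' K) ((fun x => k + x) '' L) := by
    refine measure_mono_null (t := {k + l}) ?_ (by simp)
    rintro _ ⟨⟨x, hx, rfl⟩, ⟨y, hy, hxy⟩⟩
    have := hkmax hx
    have := hlmin hy
    simp only [Set.mem_singleton_iff]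
    simp only at hxy
    linarith
  have hm : NullMeasurableSet ((fun x => k + x) '' L) volume :=
    (hL.image (by fun_prop)).measurableSet.nullMeasurableSet
  rw [← h1, ← h2, ← measure_union₀ hm hd]
  refine measure_mono (Set.union_subset ?_ ?_)
  · rintro _ ⟨x, hx, rfl⟩
    exact ⟨x, hx, l, hl, add_comm _ _⟩
  · rintro _ ⟨y, hy, rfl⟩
    exact ⟨k, hk, y, hy, rfl⟩

/-- The one-dimensional Brunn-Minkowski inequality for measurable sets. -/
theorem volume_add_volume_le {A B : Set ℝ} (hA : MeasurableSet A) (hB : MeasurableSet B)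
    (hA0 : A.Nonempty) (hB0 : B.Nonempty) : volume A + volume B ≤ volume (A + B) := by
  obtain ⟨x, hx⟩ := hA0
  obtain ⟨y, hy⟩ := hB0
  rw [hA.measure_eq_iSup_isCompact, hB.measure_eq_iSup_isCompact]
  simp only [iSup_and']
  refine ENNReal.biSup_add_biSup_le' ⟨∅, by simp⟩ ⟨∅, by simp⟩ fun K ⟨hKA, hK⟩ L ⟨hLB, hL⟩ => ?_
  -- The approximating compact sets may be empty, so a point of `A` or `B` is inserted.
  calc volume K + volume L ≤ volume (insert x K) + volume (insert y L) := by
        gcongr <;> exact Set.subset_insert _ _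
    _ ≤ volume (insert x K + insert y L) :=
        volume_add_volume_le_of_isCompact (hK.insert x) (hL.insert y) (Set.insert_nonempty _ _)
          (Set.insert_nonempty _ _)
    _ ≤ volume (A + B) := by
        gcongr
        · exact Set.insert_subset hx hKA
        · exact Set.insert_subset hy hLB

/-! ### Prékopa-Leindler inequality -/

theorem ENNReal.rpow_mul_rpow_le_add {a b : ℝ} (ha : 0 < a) (hb : 0 < b) (hab : a + b = 1)
    (x y : ℝ≥0∞) : x ^ a * y ^ b ≤ ENNReal.ofReal a * x + ENNReal.ofReal b * y := by
  induction x with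
  | top => simp [ENNReal.mul_top, ha]
  | coe x =>
  induction y with
  | top => simp [ENNReal.mul_top, hb]
  | coe y =>
  have := NNReal.geom_mean_le_arith_mean2_weighted ⟨a, ha.le⟩ ⟨b, hb.le⟩ x y (NNReal.eq hab)
  rw [← ENNReal.coe_rpow_of_nonneg _ ha.le, ← ENNReal.coe_rpow_of_nonneg _ hb.le,
    ENNReal.ofReal_eq_coe_nnreal ha.le, ENNReal.ofReal_eq_coe_nnreal hb.le]
  exact_mod_cast this

/-- The additive form of the one-dimensional Prékopa-Leindler inequality, for functions normalized
to have supremum one. -/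
theorem lintegral_add_le_of_superlevel {a b : ℝ} (ha : 0 < a) (hb : 0 < b)
    {u v w : ℝ → ℝ} (hu : Measurable u) (hv : Measurable v) (hw : Measurable w)
    (hu0 : ∀ x, 0 ≤ u x) (hv0 : ∀ x, 0 ≤ v x) (hw0 : ∀ x, 0 ≤ w x)
    (hu1 : ∀ x, u x ≤ 1) (hv1 : ∀ x, v x ≤ 1)
    (hus : ∀ t < 1, ∃ x, t < u x) (hvs : ∀ t < 1, ∃ x, t < v x)
    (h : ∀ x y t, 0 < t → t < u x → t < v y → t < w (a * x + b * y)) :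
    ENNReal.ofReal a * (∫⁻ x, ENNReal.ofReal (u x)) +
        ENNReal.ofReal b * (∫⁻ x, ENNReal.ofReal (v x)) ≤
      ∫⁻ x, ENNReal.ofReal (w x) := by
  rw [lintegral_eq_lintegral_meas_lt volume (.of_forall hu0) hu.aemeasurable,
    lintegral_eq_lintegral_meas_lt volume (.of_forall hv0) hv.aemeasurable,
    lintegral_eq_lintegral_meas_lt volume (.of_forall hw0) hw.aemeasurable]
  have hanti : ∀ z : ℝ → ℝ, Measurable fun t => volume {x | t < z x} := fun z =>
    Antitone.measurable fun s t hst => measure_mono fun x (hx : t < z x) => hst.trans_lt hx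
  rw [← lintegral_const_mul _ (hanti u), ← lintegral_const_mul _ (hanti v),
    ← lintegral_add_left ((hanti u).const_mul _)]
  refine setLIntegral_mono (hanti w) fun t ht => ?_
  -- Brunn-Minkowski needs nonempty sets. At levels `t ≥ 1` both superlevel sets are empty; below 1
  -- neither is.
  rcases le_or_gt 1 t with h1 | h1
  · have e1 : {x | t < u x} = ∅ := by
      ext x; simpa using (hu1 x).trans h1
    have e2 : {x | t < v x} = ∅ := by
      ext x; simpa using (hv1 x).trans h1
    simp [e1, e2]
  have s1 := Measure.addHaar_smul volume a {x | t < u x}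
  have s2 := Measure.addHaar_smul volume b {x | t < v x}
  simp only [Module.finrank_self, pow_one, abs_of_pos ha, abs_of_pos hb] at s1 s2
  rw [← s1, ← s2]
  refine (volume_add_volume_le ((measurableSet_lt measurable_const hu).const_smul₀ a)
    ((measurableSet_lt measurable_const hv).const_smul₀ b) (Set.Nonempty.smul_set (hus t h1))
    (Set.Nonempty.smul_set (hvs t h1))).trans (measure_mono ?_)
  rintro _ ⟨_, ⟨x, hx, rfl⟩, _, ⟨y, hy, rfl⟩, rfl⟩
  exact h x y t ht hx hy

/-- A measured real vector space satisfies the Prékopa-Leindler inequality. -/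
def PrekopaLeindler (E : Type*) [AddCommGroup E] [Module ℝ E] [MeasureSpace E] : Prop :=
  ∀ (a b : ℝ), 0 < a → 0 < b → a + b = 1 → ∀ f g h : E → ℝ≥0∞,
    Measurable f → Measurable g → Measurable h →
    (∀ x y, f x ^ a * g y ^ b ≤ h (a • x + b • y)) →
    (∫⁻ x, f x) ^ a * (∫⁻ x, g x) ^ b ≤ ∫⁻ x, h x

/-- Dividing `f`, `g` by their suprema `A`, `B` and `h` by `A ^ a * B ^ b` preserves the hypothesis
and reduces to the additive form; the weighted AM-GM inequality then returns to products. Capping `h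
/ C` at 1 only keeps it finite. -/
theorem lintegral_rpow_mul_le_of_bounded {a b : ℝ} (ha : 0 < a) (hb : 0 < b) (hab : a + b = 1)
    {f g h : ℝ → ℝ≥0∞} (hf : Measurable f) (hg : Measurable g) (hh : Measurable h)
    (hfb : ⨆ x, f x ≠ ∞) (hgb : ⨆ x, g x ≠ ∞)
    (hfgh : ∀ x y, f x ^ a * g y ^ b ≤ h (a • x + b • y)) :
    (∫⁻ x, f x) ^ a * (∫⁻ x, g x) ^ b ≤ ∫⁻ x, h x := by
  set A := ⨆ x, f x with hA
  set B := ⨆ x, g x with hB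
  have hfA : ∀ x, f x ≤ A := fun x => le_iSup f x
  have hgB : ∀ x, g x ≤ B := fun x => le_iSup g x
  rcases eq_or_ne A 0 with hA0 | hA0
  · have : ∀ x, f x = 0 := fun x => le_antisymm ((hfA x).trans hA0.le) zero_le
    simp [this, ha]
  rcases eq_or_ne B 0 with hB0 | hB0
  · have : ∀ x, g x = 0 := fun x => le_antisymm ((hgB x).trans hB0.le) zero_le
    simp [this, hb]
  set C := A ^ a * B ^ b with hC
  have hAa0 : A ^ a ≠ 0 := by simp [hA0, hfb]
  have hBb0 : B ^ b ≠ 0 := by simp [hB0, hgb]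
  have hAat : A ^ a ≠ ∞ := by simp [hA0, hfb]
  have hBbt : B ^ b ≠ ∞ := by simp [hB0, hgb]
  have hC0 : C ≠ 0 := mul_ne_zero hAa0 hBb0
  have hCt : C ≠ ∞ := ENNReal.mul_ne_top hAat hBbt
  have hdiv : ∀ x y : ℝ≥0∞, (x / A) ^ a * (y / B) ^ b = x ^ a * y ^ b / C := by
    intro x y
    rw [ENNReal.div_rpow_of_nonneg _ _ ha.le, ENNReal.div_rpow_of_nonneg _ _ hb.le, hC,
      div_eq_mul_inv, div_eq_mul_inv, div_eq_mul_inv, ENNReal.mul_inv (.inl hAa0) (.inl hAat)]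
    ring
  have hf1 : ∀ x, f x / A ≤ 1 := fun x => ENNReal.div_le_of_le_mul (by simpa using hfA x)
  have hg1 : ∀ x, g x / B ≤ 1 := fun x => ENNReal.div_le_of_le_mul (by simpa using hgB x)
  have hft : ∀ x, f x / A ≠ ∞ := fun x => ne_top_of_le_ne_top ENNReal.one_ne_top (hf1 x)
  have hgt : ∀ x, g x / B ≠ ∞ := fun x => ne_top_of_le_ne_top ENNReal.one_ne_top (hg1 x)
  have hwt : ∀ x, min (h x / C) 1 ≠ ∞ := fun x =>
    ne_top_of_le_ne_top ENNReal.one_ne_top (min_le_right _ _)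
  have hlt : ∀ (z : ℝ → ℝ≥0∞), ⨆ x, z x ≠ 0 → ⨆ x, z x ≠ ∞ → (∀ x, z x / (⨆ x, z x) ≠ ∞) →
      ∀ t < (1 : ℝ), ∃ x, t < (z x / (⨆ x, z x)).toReal := by
    intro z hz0 hzt hzx t ht
    by_contra! hcon
    have h1 : ∀ x, z x ≤ ENNReal.ofReal t * ⨆ x, z x := fun x => by
      rw [← ENNReal.div_le_iff hz0 hzt]
      exact ENNReal.le_ofReal_iff_toReal_le (hzx x) (ENNReal.toReal_nonneg.trans (hcon x)) |>.2 (hcon x)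
    have h2 : ⨆ x, z x ≤ ENNReal.ofReal t * ⨆ x, z x := iSup_le h1
    have h3 : ENNReal.ofReal t * ⨆ x, z x < 1 * ⨆ x, z x :=
      (ENNReal.mul_lt_mul_iff_left hz0 hzt).2 (by simpa using ht)
    rw [one_mul] at h3
    exact h2.not_gt h3
  have key := lintegral_add_le_of_superlevel (u := fun x => (f x / A).toReal)
    (v := fun x => (g x / B).toReal) (w := fun x => (min (h x / C) 1).toReal) ha hb
    (by fun_prop) (by fun_prop) (by fun_prop) (fun _ => ENNReal.toReal_nonneg)
    (fun _ => ENNReal.toReal_nonneg) (fun _ => ENNReal.toReal_nonneg)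
    (fun x => ENNReal.toReal_le_of_le_ofReal one_pos.le (by simpa using hf1 x))
    (fun x => ENNReal.toReal_le_of_le_ofReal one_pos.le (by simpa using hg1 x))
    (hlt f hA0 hfb hft) (hlt g hB0 hgb hgt) (by
      intro x y t ht h1 h2
      rw [← ENNReal.ofReal_lt_iff_lt_toReal ht.le (hft x)] at h1
      rw [← ENNReal.ofReal_lt_iff_lt_toReal ht.le (hgt y)] at h2
      rw [← ENNReal.ofReal_lt_iff_lt_toReal ht.le (hwt _)]
      have ht0 : ENNReal.ofReal t ≠ 0 := by simpa using ht
      have h3 : ENNReal.ofReal t < (f x / A) ^ a * (g y / B) ^ b := by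
        calc ENNReal.ofReal t = ENNReal.ofReal t ^ a * ENNReal.ofReal t ^ b := by
              rw [← ENNReal.rpow_add _ _ ht0 ENNReal.ofReal_ne_top, hab, ENNReal.rpow_one]
          _ < _ := ENNReal.mul_lt_mul (ENNReal.rpow_lt_rpow h1 ha) (ENNReal.rpow_lt_rpow h2 hb)
      refine lt_min (h3.trans_le ?_) (h3.trans_le ?_)
      · rw [hdiv]
        exact ENNReal.div_le_div_right (hfgh x y) _
      · exact mul_le_one' (ENNReal.rpow_le_one (hf1 x) ha.le) (ENNReal.rpow_le_one (hg1 y) hb.le))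
  simp only [ENNReal.ofReal_toReal (hft _), ENNReal.ofReal_toReal (hgt _),
    ENNReal.ofReal_toReal (hwt _)] at key
  have hle : ∫⁻ x, min (h x / C) 1 ≤ (∫⁻ x, h x) / C := by
    calc ∫⁻ x, min (h x / C) 1 ≤ ∫⁻ x, h x / C := lintegral_mono fun x => min_le_left _ _
      _ = (∫⁻ x, h x) / C := by simp only [div_eq_mul_inv]; rw [lintegral_mul_const _ hh]
  have hfi : ∫⁻ x, f x / A = (∫⁻ x, f x) / A := by
    simp only [div_eq_mul_inv]; rw [lintegral_mul_const _ hf]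
  have hgi : ∫⁻ x, g x / B = (∫⁻ x, g x) / B := by
    simp only [div_eq_mul_inv]; rw [lintegral_mul_const _ hg]
  rw [hfi, hgi] at key
  have := (ENNReal.rpow_mul_rpow_le_add ha hb hab _ _).trans (key.trans hle)
  rwa [hdiv, ENNReal.div_le_iff hC0 hCt, ENNReal.div_mul_cancel hC0 hCt] at this

theorem prekopaLeindler_real : PrekopaLeindler ℝ := by
  intro a b ha hb hab f g h hf hg hh hfgh
  have hmono : ∀ z : ℝ → ℝ≥0∞, Monotone fun (n : ℕ) x => min (z x) n := fun z m n hmn x =>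
    min_le_min_left _ (by exact_mod_cast hmn)
  have hsup : ∀ z : ℝ → ℝ≥0∞, Measurable z → ∫⁻ x, z x = ⨆ n : ℕ, ∫⁻ x, min (z x) n := by
    intro z hz
    rw [← lintegral_iSup (fun n => by fun_prop) (hmono z)]
    congr with x
    rw [← inf_iSup_eq, ENNReal.iSup_natCast, inf_top_eq]
  have hlim : ∀ z : ℝ → ℝ≥0∞, Measurable z →
      Filter.Tendsto (fun n : ℕ => ∫⁻ x, min (z x) n) Filter.atTop (nhds (∫⁻ x, z x)) := by
    intro z hz
    rw [hsup z hz]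
    exact tendsto_atTop_iSup fun m n hmn => lintegral_mono (hmono z hmn)
  have hn : ∀ n : ℕ, (∫⁻ x, min (f x) n) ^ a * (∫⁻ x, min (g x) n) ^ b ≤ ∫⁻ x, h x := by
    intro n
    have hb' : ∀ z : ℝ → ℝ≥0∞, ⨆ x, min (z x) n ≠ ∞ := fun z =>
      ne_top_of_le_ne_top (ENNReal.natCast_ne_top n) (iSup_le fun x => min_le_right _ _)
    refine lintegral_rpow_mul_le_of_bounded ha hb hab (by fun_prop) (by fun_prop) hh (hb' f) (hb' g)
      fun x y => le_trans ?_ (hfgh x y)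
    gcongr <;> exact min_le_left _ _
  -- Zero integrals are set aside because multiplication is discontinuous at `0 * ∞`.
  rcases eq_or_ne (∫⁻ x, f x) 0 with h0 | h0
  · simp [h0, ha]
  rcases eq_or_ne (∫⁻ x, g x) 0 with h1 | h1
  · simp [h1, hb]
  refine le_of_tendsto (ENNReal.Tendsto.mul ((hlim f hf).ennrpow_const a) (.inl ?_)
    ((hlim g hg).ennrpow_const b) (.inl ?_)) (.of_forall hn)
  · simp [h0, ha.le]
  · simp [h1, hb.le]

/-- The inequality on the fibres `F` is the hypothesis on `E` for the partial integrals. -/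
theorem PrekopaLeindler.prod {E F : Type*} [AddCommGroup E] [Module ℝ E] [MeasureSpace E]
    [AddCommGroup F] [Module ℝ F] [MeasureSpace F] [SFinite (volume : Measure E)] [SFinite (volume : Measure F)]
    (hE : PrekopaLeindler E) (hF : PrekopaLeindler F) : PrekopaLeindler (E × F) := by
  intro a b ha hb hab f g h hf hg hh hfgh
  have hprod : ∀ z : E × F → ℝ≥0∞, Measurable z → ∫⁻ p, z p = ∫⁻ x, ∫⁻ y, z (x, y) := fun z hz =>
    lintegral_prod _ hz.aemeasurable
  rw [hprod f hf, hprod g hg, hprod h hh]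
  refine hE a b ha hb hab _ _ _ hf.lintegral_prod_right' hg.lintegral_prod_right'
    hh.lintegral_prod_right' fun x x' => ?_
  exact hF a b ha hb hab _ _ _ (by fun_prop) (by fun_prop) (by fun_prop) fun y y' => hfgh (x, y) (x', y')

theorem PrekopaLeindler.of_measurePreserving {E F : Type*} [AddCommGroup E] [Module ℝ E]
    [MeasureSpace E] [AddCommGroup F] [Module ℝ F] [MeasureSpace F] (hE : PrekopaLeindler E)
    (e : E →ₗ[ℝ] F) (he : MeasurePreserving e) : PrekopaLeindler F := by
  intro a b ha hb hab f g h hf hg hh hfgh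
  rw [← he.lintegral_comp hf, ← he.lintegral_comp hg, ← he.lintegral_comp hh]
  refine hE a b ha hb hab _ _ _ (hf.comp he.measurable) (hg.comp he.measurable)
    (hh.comp he.measurable) fun x y => ?_
  simpa using hfgh (e x) (e y)

theorem prekopaLeindler_pi (n : ℕ) : PrekopaLeindler (Fin n → ℝ) := by
  induction n with
  | zero =>
    intro a b ha hb hab f g h hf hg hh hfgh
    have : ∀ z : (Fin 0 → ℝ) → ℝ≥0∞, ∫⁻ x, z x = z 0 := fun z => by
      rw [Measure.volume_pi_eq_dirac (0 : Fin 0 → ℝ), lintegral_dirac]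
    rw [this, this, this]
    simpa using hfgh 0 0
  | succ n ih =>
    refine (prekopaLeindler_real.prod ih).of_measurePreserving
      (Fin.consLinearEquiv ℝ (fun _ : Fin (n + 1) => ℝ)).toLinearMap ?_
    have heq : ((Fin.consLinearEquiv ℝ (fun _ : Fin (n + 1) => ℝ)).toLinearMap :
        ℝ × (Fin n → ℝ) → Fin (n + 1) → ℝ) =
        (MeasurableEquiv.piFinSuccAbove (fun _ : Fin (n + 1) => ℝ) 0).symm := by
      ext p i
      refine Fin.cases ?_ (fun j => ?_) i <;> simp [Fin.consLinearEquiv]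
    rw [heq]
    exact (volume_preserving_piFinSuccAbove (fun _ : Fin (n + 1) => ℝ) 0).symm

/-- The Prékopa-Leindler inequality in Euclidean space. -/
theorem prekopaLeindler_euclideanSpace (n : ℕ) : PrekopaLeindler (EuclideanSpace ℝ (Fin n)) :=
  (prekopaLeindler_pi n).of_measurePreserving
    (WithLp.linearEquiv 2 ℝ (Fin n → ℝ)).symm.toLinearMap (PiLp.volume_preserving_toLp _)

/-! ### Regularity of log-concave functions -/

theorem IsLogConcave.convex_support {E : Type*} [AddCommGroup E] [Module ℝ E] {f : E → ℝ}
    (hf : IsLogConcave f) : Convex ℝ {x | 0 < f x} := by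
  rw [convex_iff_forall_pos]
  intro x hx y hy a b ha hb hab
  exact (mul_pos (Real.rpow_pos_of_pos hx a) (Real.rpow_pos_of_pos hy b)).trans_le
    (hf.le_apply x y a b ha hb hab)

theorem IsLogConcave.concaveOn_log {E : Type*} [AddCommGroup E] [Module ℝ E] {f : E → ℝ}
    (hf : IsLogConcave f) : ConcaveOn ℝ {x | 0 < f x} fun x => Real.log (f x) := by
  rw [concaveOn_iff_forall_pos]
  refine ⟨hf.convex_support, fun x hx y hy a b ha hb hab => ?_⟩
  have hx' := Real.rpow_pos_of_pos hx a
  have hy' := Real.rpow_pos_of_pos hy b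
  have := Real.log_le_log (mul_pos hx' hy') (hf.le_apply x y a b ha hb hab)
  rwa [Real.log_mul hx'.ne' hy'.ne', Real.log_rpow hx, Real.log_rpow hy] at this

/-- A log-concave function agrees almost everywhere with a Borel measurable log-concave function. -/
theorem IsLogConcave.exists_measurable {E : Type*} [NormedAddCommGroup E] [NormedSpace ℝ E]
    [FiniteDimensional ℝ E] [MeasurableSpace E] [BorelSpace E] (μ : Measure E) [μ.IsAddHaarMeasure]
    {f : E → ℝ} (hf : IsLogConcave f) :
    ∃ g : E → ℝ, Measurable g ∧ IsLogConcave g ∧ g =ᵐ[μ] f := by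
  classical
  set S := {x | 0 < f x} with hS
  have hSc : Convex ℝ S := hf.convex_support
  -- The concave function `log f` is continuous on the interior of its convex domain, whose frontier
  -- is null.
  refine ⟨(interior S).indicator f, ?_, ⟨?_, ?_⟩, ?_⟩
  · have hcont : ContinuousOn f (interior S) :=
      (Real.continuous_exp.comp_continuousOn hf.concaveOn_log.continuousOn_interior).congr
        fun x hx => (Real.exp_log (interior_subset hx : x ∈ S)).symm
    rw [← Set.piecewise_eq_indicator]
    exact hcont.measurable_piecewise continuousOn_const isOpen_interior.measurableSet
  · exact fun x => Set.indicator_nonneg (fun y _ => hf.nonneg y) x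
  · intro x y a b ha hb hab
    have hn : 0 ≤ (interior S).indicator f (a • x + b • y) :=
      Set.indicator_nonneg (fun y _ => hf.nonneg y) _
    by_cases hx : x ∈ interior S
    · by_cases hy : y ∈ interior S
      · have := hSc.interior hx hy ha.le hb.le hab
        simpa [hx, hy, this] using hf.le_apply x y a b ha hb hab
      · simpa [hy, Real.zero_rpow hb.ne'] using hn
    · simpa [hx, Real.zero_rpow ha.ne'] using hn
  · have hnull := hSc.addHaar_frontier μ
    filter_upwards [measure_eq_zero_iff_ae_notMem.1 hnull] with x hx
    by_cases hxi : x ∈ interior S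
    · simp [hxi]
    · have hxS : x ∉ S := fun h => hx ⟨subset_closure h, hxi⟩
      have : f x = 0 := le_antisymm (not_lt.1 hxS) (hf.nonneg x)
      simp [hxi, this]

/-! ### Log-concavity in the exponent -/

theorem lintegral_inv_smul {n : ℕ} {g : EuclideanSpace ℝ (Fin n) → ℝ≥0∞} (hg : Measurable g) {r : ℝ}
    (hr : 0 < r) : ∫⁻ x, g (r⁻¹ • x) = ENNReal.ofReal (r ^ n) * ∫⁻ x, g x := by
  rw [← lintegral_map hg (measurable_const_smul _), Measure.map_addHaar_smul _ (inv_ne_zero hr.ne'),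
    lintegral_smul_measure]
  simp [abs_of_pos hr]

/-- For a log-concave function `f` on `ℝⁿ`, the function `p ↦ pⁿ ∫ fᵖ` is log-concave. -/
theorem IsLogConcave.lintegral_rpow_mul_le {n : ℕ} {f : EuclideanSpace ℝ (Fin n) → ℝ}
    (hf : IsLogConcave f) {p q a b : ℝ} (hp : 0 < p) (hq : 0 < q) (ha : 0 < a) (hb : 0 < b)
    (hab : a + b = 1) :
    (ENNReal.ofReal (p ^ n) * ∫⁻ x, ENNReal.ofReal (f x ^ p)) ^ a *
        (ENNReal.ofReal (q ^ n) * ∫⁻ x, ENNReal.ofReal (f x ^ q)) ^ b ≤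
      ENNReal.ofReal ((a * p + b * q) ^ n) * ∫⁻ x, ENNReal.ofReal (f x ^ (a * p + b * q)) := by
  obtain ⟨g, hgm, hg, hgf⟩ := hf.exists_measurable volume
  have hcongr : ∀ r : ℝ, ∫⁻ x, ENNReal.ofReal (f x ^ r) = ∫⁻ x, ENNReal.ofReal (g x ^ r) := fun r =>
    lintegral_congr_ae (hgf.mono fun x hx => by simp only [hx])
  rw [hcongr, hcongr, hcongr]
  have hr : 0 < a * p + b * q := by positivity
  set r := a * p + b * q with hrdef
  have hm : ∀ p : ℝ, Measurable fun x => ENNReal.ofReal (g x ^ p) := fun p => by fun_prop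
  rw [← lintegral_inv_smul (hm p) hp, ← lintegral_inv_smul (hm q) hq, ← lintegral_inv_smul (hm r) hr]
  refine prekopaLeindler_euclideanSpace n a b ha hb hab _ _ _ ((hm p).comp (measurable_const_smul _))
    ((hm q).comp (measurable_const_smul _)) ((hm r).comp (measurable_const_smul _)) fun x y => ?_
  have hx := hg.nonneg (p⁻¹ • x)
  have hy := hg.nonneg (q⁻¹ • y)
  rw [ENNReal.ofReal_rpow_of_nonneg (by positivity) ha.le,
    ENNReal.ofReal_rpow_of_nonneg (by positivity) hb.le, ← ENNReal.ofReal_mul (by positivity)]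
  refine ENNReal.ofReal_le_ofReal ?_
  -- These weights turn `x / p` and `y / q` into `(a x + b y) / r`; the `r`-th power then produces
  -- the exponents `a p` and `b q`.
  have key := hg.le_apply (p⁻¹ • x) (q⁻¹ • y) (a * p / r) (b * q / r) (by positivity) (by positivity)
    (by rw [← add_div, ← hrdef, div_self hr.ne'])
  have harg : (a * p / r) • p⁻¹ • x + (b * q / r) • q⁻¹ • y = r⁻¹ • (a • x + b • y) := by
    simp only [smul_add, smul_smul]
    congr 2 <;> field_simp
  rw [harg] at key
  refine le_trans (le_of_eq ?_) (Real.rpow_le_rpow (by positivity) key hr.le)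
  rw [Real.mul_rpow (by positivity) (by positivity), ← Real.rpow_mul hx, ← Real.rpow_mul hy,
    ← Real.rpow_mul hx, ← Real.rpow_mul hy]
  congr 2 <;> field_simp

theorem lintegral_rpow_ne_zero {E : Type*} [MeasurableSpace E] {μ : Measure E} {f : E → ℝ}
    (hfm : AEMeasurable f μ) (hf : ∫⁻ x, ENNReal.ofReal (f x) ∂μ ≠ 0) (p : ℝ) :
    ∫⁻ x, ENNReal.ofReal (f x ^ p) ∂μ ≠ 0 := by
  contrapose! hf
  rw [lintegral_eq_zero_iff' (by fun_prop)] at hf ⊢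
  filter_upwards [hf] with x hx
  simp only [Pi.zero_apply, ENNReal.ofReal_eq_zero] at hx ⊢
  by_contra! h
  exact (Real.rpow_pos_of_pos h p).not_ge hx

/-- All positive powers of a log-concave probability density are integrable. -/
theorem IsLogConcave.lintegral_rpow_ne_top {n : ℕ} {f : EuclideanSpace ℝ (Fin n) → ℝ}
    (hf : IsLogConcave f) (hfm : AEMeasurable f) (hf1 : ∫⁻ x, ENNReal.ofReal (f x) = 1) {p : ℝ}
    (hp : 0 < p) : ∫⁻ x, ENNReal.ofReal (f x ^ p) ≠ ∞ := by
  intro htop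
  -- If 1 lies strictly between `p` and some `q`, an infinite integral at `p` forces `∫ f = ∞`.
  -- Below, `q = 2` or `q = 1 / 2`.
  have key : ∀ q a b : ℝ, 0 < q → 0 < a → 0 < b → a + b = 1 → a * p + b * q = 1 → False := by
    intro q a b hq ha hb hab h1
    have h := hf.lintegral_rpow_mul_le hp hq ha hb hab
    have hq0 : ∫⁻ x, ENNReal.ofReal (f x ^ q) ≠ 0 :=
      lintegral_rpow_ne_zero hfm (by simp [hf1]) q
    have hpn : ENNReal.ofReal (p ^ n) ≠ 0 := by simpa using pow_pos hp n
    have hqn : ENNReal.ofReal (q ^ n) ≠ 0 := by simpa using pow_pos hq n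
    have hne : (ENNReal.ofReal (q ^ n) * ∫⁻ x, ENNReal.ofReal (f x ^ q)) ^ b ≠ 0 := by
      simp only [ne_eq, ENNReal.rpow_eq_zero_iff, not_or, not_and_or]
      exact ⟨.inl (mul_ne_zero hqn hq0), .inr hb.not_gt⟩
    rw [h1, htop, ENNReal.mul_top hpn, ENNReal.top_rpow_of_pos ha, ENNReal.top_mul hne] at h
    simp [hf1] at h
  rcases lt_trichotomy p 1 with h | h | h
  · have : 0 < 2 - p := by linarith
    exact key 2 (1 / (2 - p)) ((1 - p) / (2 - p)) two_pos (by positivity)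
      (div_pos (by linarith) this) (by field_simp; ring) (by field_simp; ring)
  · simp [h, hf1] at htop
  · have : 0 < 2 * p - 1 := by linarith
    exact key (1 / 2) (1 / (2 * p - 1)) ((2 * p - 2) / (2 * p - 1)) (by norm_num) (by positivity)
      (div_pos (by linarith) this) (by field_simp; ring) (by field_simp; ring)

theorem IsLogConcave.concaveOn_log_lintegral_rpow {n : ℕ} {f : EuclideanSpace ℝ (Fin n) → ℝ}
    (hf : IsLogConcave f) (hfm : AEMeasurable f) (hf1 : ∫⁻ x, ENNReal.ofReal (f x) = 1) :
    ConcaveOn ℝ (Set.Ioi 0)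
      fun p : ℝ => Real.log (p ^ n * (∫⁻ x, ENNReal.ofReal (f x ^ p)).toReal) := by
  rw [concaveOn_iff_forall_pos]
  refine ⟨convex_Ioi 0, fun p hp q hq a b ha hb hab => ?_⟩
  simp only [Set.mem_Ioi] at hp hq
  have hpos : ∀ {p : ℝ}, 0 < p → 0 < p ^ n * (∫⁻ x, ENNReal.ofReal (f x ^ p)).toReal := fun hp =>
    mul_pos (pow_pos hp n) (ENNReal.toReal_pos
      (lintegral_rpow_ne_zero hfm (by simp [hf1]) _) (hf.lintegral_rpow_ne_top hfm hf1 hp))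
  have hr : 0 < a * p + b * q := by positivity
  have h := ENNReal.toReal_mono (ENNReal.mul_ne_top ENNReal.ofReal_ne_top
    (hf.lintegral_rpow_ne_top hfm hf1 hr)) (hf.lintegral_rpow_mul_le hp hq ha hb hab)
  simp only [ENNReal.toReal_mul, ← ENNReal.toReal_rpow,
    ENNReal.toReal_ofReal (pow_pos hp n).le, ENNReal.toReal_ofReal (pow_pos hq n).le,
    ENNReal.toReal_ofReal (pow_pos hr n).le] at h
  have h1 := Real.rpow_pos_of_pos (hpos hp) a
  have h2 := Real.rpow_pos_of_pos (hpos hq) b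
  have h3 := Real.log_le_log (mul_pos h1 h2) h
  rwa [Real.log_mul h1.ne' h2.ne', Real.log_rpow (hpos hp), Real.log_rpow (hpos hq)] at h3

/-! ### Exponential moments of `log f(X)` -/

open ProbabilityTheory

theorem ConcaveOn.le_add_mul_of_hasDerivAt {S : Set ℝ} {f : ℝ → ℝ} (hf : ConcaveOn ℝ S f)
    {x y f' : ℝ} (hx : x ∈ S) (hy : y ∈ S) (hd : HasDerivAt f f' x) :
    f y ≤ f x + f' * (y - x) := by
  rcases lt_trichotomy x y with h | rfl | h
  · have := hf.slope_le_of_hasDerivAt hx hy h hd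
    rw [slope_def_field, div_le_iff₀ (sub_pos.2 h)] at this
    linarith
  · simp
  · have := hf.le_slope_of_hasDerivAt hy hx h hd
    rw [slope_def_field, le_div_iff₀ (sub_pos.2 h)] at this
    linarith

section Density

variable {Ω : Type*} [MeasurableSpace Ω] {P : Measure Ω} {n : ℕ}
  {X : Ω → EuclideanSpace ℝ (Fin n)} {f : EuclideanSpace ℝ (Fin n) → ℝ}

theorem HasLebesgueDensity.map_absolutelyContinuous (hX : HasLebesgueDensity P X f) :
    P.map X ≪ volume := by
  rw [hX.map_eq]
  exact withDensity_absolutelyContinuous _ _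

theorem HasLebesgueDensity.lintegral_comp (hX : HasLebesgueDensity P X f)
    {g : EuclideanSpace ℝ (Fin n) → ENNReal} (hg : AEMeasurable g) :
    ∫⁻ ω, g (X ω) ∂P = ∫⁻ x, ENNReal.ofReal (f x) * g x := by
  rw [← lintegral_map' (hg.mono_ac hX.map_absolutelyContinuous) hX.aemeasurable, hX.map_eq,
    lintegral_withDensity_eq_lintegral_mul₀ hX.aemeasurable_density.ennreal_ofReal hg]
  rfl

theorem HasLebesgueDensity.integral_comp (hX : HasLebesgueDensity P X f) (hf : ∀ x, 0 ≤ f x)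
    {g : EuclideanSpace ℝ (Fin n) → ℝ} (hg : AEMeasurable g) :
    ∫ ω, g (X ω) ∂P = ∫ x, f x * g x := by
  rw [← integral_map hX.aemeasurable
      (hg.mono_ac hX.map_absolutelyContinuous).aestronglyMeasurable, hX.map_eq,
    integral_withDensity_eq_integral_toReal_smul₀ hX.aemeasurable_density.ennreal_ofReal (by simp)]
  simp [ENNReal.toReal_ofReal, hf]

theorem HasLebesgueDensity.integrable_comp_iff (hX : HasLebesgueDensity P X f) (hf : ∀ x, 0 ≤ f x)
    {g : EuclideanSpace ℝ (Fin n) → ℝ} (hg : AEMeasurable g) :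
    Integrable (fun ω => g (X ω)) P ↔ Integrable fun x => f x * g x := by
  have h := integrable_map_measure (μ := P)
    (hg.mono_ac hX.map_absolutelyContinuous).aestronglyMeasurable hX.aemeasurable
  rw [hX.map_eq, integrable_withDensity_iff_integrable_smul₀'
    hX.aemeasurable_density.ennreal_ofReal (by simp)] at h
  simp only [ENNReal.toReal_ofReal (hf _), smul_eq_mul] at h
  exact h.symm

theorem HasLebesgueDensity.lintegral_density [IsProbabilityMeasure P]
    (hX : HasLebesgueDensity P X f) : ∫⁻ x, ENNReal.ofReal (f x) = 1 := by
  simpa using (hX.lintegral_comp (g := fun _ => 1) aemeasurable_const).symm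

theorem HasLebesgueDensity.lintegral_exp_log (hX : HasLebesgueDensity P X f) (hf : ∀ x, 0 ≤ f x)
    {s : ℝ} (hs : -1 < s) :
    ∫⁻ ω, ENNReal.ofReal (Real.exp (s * Real.log (f (X ω)))) ∂P =
      ∫⁻ x, ENNReal.ofReal (f x ^ (1 + s)) := by
  have hfm := hX.aemeasurable_density
  rw [hX.lintegral_comp (g := fun x => ENNReal.ofReal (Real.exp (s * Real.log (f x)))) (by fun_prop)]
  congr with x
  rw [← ENNReal.ofReal_mul (hf x)]
  -- Where `f = 0` the factor `f x` kills the left side, and `1 + s > 0` makes `0 ^ (1 + s) = 0`.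
  rcases (hf x).eq_or_lt with h | h
  · rw [← h, Real.zero_rpow (by linarith)]
    simp
  · rw [Real.rpow_add h, Real.rpow_one, Real.rpow_def_of_pos h, mul_comm s]

theorem HasLebesgueDensity.aemeasurable_log (hX : HasLebesgueDensity P X f) :
    AEMeasurable (fun ω => Real.log (f (X ω))) P :=
  (hX.aemeasurable_density.log.mono_ac hX.map_absolutelyContinuous).comp_aemeasurable
    hX.aemeasurable

theorem HasLebesgueDensity.mgf_log (hX : HasLebesgueDensity P X f) (hf : ∀ x, 0 ≤ f x)
    {s : ℝ} (hs : -1 < s) :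
    mgf (fun ω => Real.log (f (X ω))) P s = (∫⁻ x, ENNReal.ofReal (f x ^ (1 + s))).toReal := by
  have hm := hX.aemeasurable_log
  rw [← hX.lintegral_exp_log hf hs, mgf, integral_eq_lintegral_of_nonneg_ae
    (.of_forall fun _ => (Real.exp_pos _).le) (hm.const_mul s).exp.aestronglyMeasurable]

theorem Ioi_subset_integrableExpSet_log [IsProbabilityMeasure P] (hf : IsLogConcave f)
    (hX : HasLebesgueDensity P X f) :
    Set.Ioi (-1) ⊆ integrableExpSet (fun ω => Real.log (f (X ω))) P := by
  intro s hs
  have hm := hX.aemeasurable_log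
  have hs1 : (0 : ℝ) < 1 + s := by linarith [Set.mem_Ioi.1 hs]
  rw [integrableExpSet, Set.mem_ofPred_eq, ← lintegral_ofReal_ne_top_iff_integrable
    (hm.const_mul s).exp.aestronglyMeasurable
    (.of_forall fun _ => (Real.exp_pos _).le), hX.lintegral_exp_log hf.nonneg hs]
  exact hf.lintegral_rpow_ne_top hX.aemeasurable_density hX.lintegral_density hs1

/-- This yields both the integrability of `log f(X)` and the differentiability of its moment
generating function at 0. -/
theorem zero_mem_interior_integrableExpSet_log [IsProbabilityMeasure P] (hf : IsLogConcave f)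
    (hX : HasLebesgueDensity P X f) :
    0 ∈ interior (integrableExpSet (fun ω => Real.log (f (X ω))) P) :=
  mem_interior.2 ⟨Set.Ioi (-1), Ioi_subset_integrableExpSet_log hf hX, isOpen_Ioi, by simp⟩

/-- The sharp bound for the moment generating function of `log f(X)`. -/
theorem mgf_log_density_le [IsProbabilityMeasure P] (hf : IsLogConcave f)
    (hX : HasLebesgueDensity P X f) {s : ℝ} (hs : -1 < s) :
    mgf (fun ω => Real.log (f (X ω))) P s ≤
      Real.exp (s * (∫ ω, Real.log (f (X ω)) ∂P) + n * (s - Real.log (1 + s))) := by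
  set Y := fun ω => Real.log (f (X ω)) with hY
  have h0 := zero_mem_interior_integrableExpSet_log hf hX
  have hmgf : ∀ p : ℝ, 0 < p → (∫⁻ x, ENNReal.ofReal (f x ^ p)).toReal = mgf Y P (p - 1) := by
    intro p hp
    rw [hX.mgf_log hf.nonneg (by linarith), add_sub_cancel]
  have hconc := hf.concaveOn_log_lintegral_rpow hX.aemeasurable_density hX.lintegral_density
  have hd : HasDerivAt
      (fun p : ℝ => Real.log (p ^ n * (∫⁻ x, ENNReal.ofReal (f x ^ p)).toReal))
      (n + ∫ ω, Y ω ∂P) 1 := by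
    have h1 : HasDerivAt (fun p : ℝ => mgf Y P (p - 1)) (∫ ω, Y ω ∂P) 1 := by
      have h := hasDerivAt_mgf h0
      simp only [zero_mul, Real.exp_zero, mul_one] at h
      rw [← sub_self (1 : ℝ)] at h
      exact h.comp_sub_const 1 1
    have h2 := ((hasDerivAt_pow n (1 : ℝ)).fun_mul h1).log (by simp)
    simp only [one_pow, mul_one, sub_self, mgf_zero, one_mul, div_one] at h2
    refine h2.congr_of_eventuallyEq ?_
    filter_upwards [lt_mem_nhds one_pos] with p hp
    rw [hmgf p hp]
  have htan := hconc.le_add_mul_of_hasDerivAt (x := 1) (y := 1 + s) (by simp)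
    (by simp only [Set.mem_Ioi]; linarith) hd
  have hs1 : (0 : ℝ) < 1 + s := by linarith
  have hpos : 0 < mgf Y P s := mgf_pos (Ioi_subset_integrableExpSet_log hf hX hs)
  rw [hmgf _ hs1, hmgf _ one_pos, add_sub_cancel_left, sub_self, mgf_zero,
    Real.log_mul (pow_pos hs1 n).ne' hpos.ne', Real.log_pow] at htan
  rw [← Real.log_le_iff_le_exp hpos]
  simp only [one_pow, mul_one, Real.log_one, zero_add] at htan
  linarith

theorem sub_log_one_add_le {s : ℝ} (hs : -(1 / 2) ≤ s) : s - Real.log (1 + s) ≤ 2 * s ^ 2 := by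
  have h1 : (0 : ℝ) < 1 + s := by linarith
  have h2 := Real.one_sub_inv_le_log_of_pos h1
  have h3 : s - (1 - (1 + s)⁻¹) = s ^ 2 / (1 + s) := by field_simp; ring
  have h4 : s ^ 2 / (1 + s) ≤ 2 * s ^ 2 := by
    rw [div_le_iff₀ h1]
    nlinarith [sq_nonneg s]
  linarith

/-- The choice `s = ±1 / (2 √n)` makes `n * (2 * s ^ 2) = 1 / 2`, and `n ≥ 1` ensures `|s| ≤ 1 / 2`.
The exponential of the absolute value is at most the sum of the two one-sided exponentials. -/
theorem integrable_exp_abs_log_density_sub_integral [IsProbabilityMeasure P] (hf : IsLogConcave f)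
    (hX : HasLebesgueDensity P X f) (hn : 1 ≤ n) :
    Integrable (fun ω => Real.exp (|Real.log (f (X ω)) - ∫ ω, Real.log (f (X ω)) ∂P| /
      (2 * Real.sqrt n))) P ∧
    ∫ ω, Real.exp (|Real.log (f (X ω)) - ∫ ω, Real.log (f (X ω)) ∂P| / (2 * Real.sqrt n)) ∂P ≤
      2 * Real.exp (1 / 2) := by
  set Y := fun ω => Real.log (f (X ω)) with hY
  set m := ∫ ω, Y ω ∂P with hm
  have hn1 : 1 ≤ Real.sqrt n := Real.one_le_sqrt.2 (by exact_mod_cast hn)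
  have hsq : Real.sqrt n ^ 2 = n := Real.sq_sqrt (by positivity)
  set c := 1 / (2 * Real.sqrt n) with hc
  have hcpos : 0 < c := by positivity
  have hc2 : c ≤ 1 / 2 := by
    rw [hc, div_le_div_iff₀ (by positivity) two_pos]; linarith
  have hnc : n * (2 * c ^ 2) = 1 / 2 := by
    rw [hc, div_pow, mul_pow, hsq]
    have : (n : ℝ) ≠ 0 := by positivity
    field_simp
  have key : ∀ s : ℝ, -(1 / 2) ≤ s → s ^ 2 = c ^ 2 →
      Integrable (fun ω => Real.exp (s * (Y ω - m))) P ∧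
        ∫ ω, Real.exp (s * (Y ω - m)) ∂P ≤ Real.exp (1 / 2) := by
    intro s hs hsc
    have hs1 : -1 < s := by linarith
    have hint := Ioi_subset_integrableExpSet_log hf hX hs1
    have heq : (fun ω => Real.exp (s * (Y ω - m))) =
        fun ω => Real.exp (s * Y ω) * Real.exp (-(s * m)) := by
      ext ω; rw [← Real.exp_add]; ring_nf
    rw [heq]
    refine ⟨Integrable.mul_const hint _, ?_⟩
    rw [integral_mul_const]
    calc _ ≤ Real.exp (s * m + n * (s - Real.log (1 + s))) * Real.exp (-(s * m)) := by
          gcongr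
          exact mgf_log_density_le hf hX hs1
      _ = Real.exp (n * (s - Real.log (1 + s))) := by rw [← Real.exp_add]; ring_nf
      _ ≤ Real.exp (n * (2 * s ^ 2)) := by
          gcongr
          exact sub_log_one_add_le hs
      _ = Real.exp (1 / 2) := by rw [hsc, hnc]
  obtain ⟨i1, b1⟩ := key c (by linarith) rfl
  obtain ⟨i2, b2⟩ := key (-c) (by linarith) (by ring)
  have hle : ∀ ω, Real.exp (|Y ω - m| / (2 * Real.sqrt n)) ≤
      Real.exp (c * (Y ω - m)) + Real.exp (-c * (Y ω - m)) := by
    intro ω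
    rw [div_eq_mul_one_div, mul_comm]
    rcases abs_cases (Y ω - m) with ⟨h, -⟩ | ⟨h, -⟩
    · rw [h]; linarith [Real.exp_pos (-c * (Y ω - m))]
    · rw [h, mul_neg, neg_mul]; linarith [Real.exp_pos (c * (Y ω - m))]
  have hYm : AEMeasurable Y P := hX.aemeasurable_log
  have hint : Integrable (fun ω => Real.exp (|Y ω - m| / (2 * Real.sqrt n))) P := by
    refine (i1.add i2).mono' (by fun_prop) (.of_forall fun ω => ?_)
    rw [Real.norm_of_nonneg (Real.exp_pos _).le]
    exact hle ω
  refine ⟨hint, ?_⟩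
  calc _ ≤ ∫ ω, (Real.exp (c * (Y ω - m)) + Real.exp (-c * (Y ω - m))) ∂P :=
        integral_mono hint (i1.add i2) hle
    _ ≤ _ := by rw [integral_add i1 i2]; linarith

end Density

/-! ### Tail bound and Orlicz norm -/

theorem theorem1p1 :
    ∃ C : ℝ, 0 < C ∧
      ∀ (n : ℕ), 1 ≤ n →
      ∀ (Ω : Type*) [MeasurableSpace Ω] (P : Measure Ω) [IsProbabilityMeasure P]
        (X : Ω → EuclideanSpace ℝ (Fin n)) (f : EuclideanSpace ℝ (Fin n) → ℝ),
        IsLogConcave f → HasLebesgueDensity P X f →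
          Integrable (fun x => f x * Real.log (f x)) volume ∧
          (∀ t : ℝ, 0 < t →
            P.real {ω | t * Real.sqrt n ≤ |informationContent X f ω - differentialEntropy f|} ≤
              2 * Real.exp (-(1 / 16) * t)) ∧
          orliczNorm psiOne P (fun ω => informationContent X f ω - differentialEntropy f) ≤
            ENNReal.ofReal (C * Real.sqrt n) := by
  refine ⟨4, by norm_num, fun n hn Ω _ P _ X f hf hX => ?_⟩
  have hlogm := hX.aemeasurable_density.log
  have hint := (hX.integrable_comp_iff hf.nonneg hlogm).1
    (integrable_of_mem_interior_integrableExpSet (zero_mem_interior_integrableExpSet_log hf hX))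
  obtain ⟨hEi, hEb⟩ := integrable_exp_abs_log_density_sub_integral hf hX hn
  rw [hX.integral_comp hf.nonneg hlogm] at hEi hEb
  set m := ∫ x, f x * Real.log (f x) with hm
  have habs : ∀ ω, |informationContent X f ω - differentialEntropy f| =
      |Real.log (f (X ω)) - m| := fun ω => by
    rw [informationContent, differentialEntropy, ← abs_neg, ← hm]; ring_nf
  have hs0 : 0 < Real.sqrt n := Real.sqrt_pos.2 (by exact_mod_cast hn)
  have hexp2 : Real.exp (1 / 2) ≤ 2 := by
    rw [← Real.le_log_iff_exp_le two_pos]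
    linarith [Real.log_two_gt_d9]
  refine ⟨hint, fun t ht => ?_, ?_⟩
  · simp only [habs]
    have hset : {ω | t * Real.sqrt n ≤ |Real.log (f (X ω)) - m|} =
        {ω | Real.exp (t / 2) ≤ Real.exp (|Real.log (f (X ω)) - m| / (2 * Real.sqrt n))} := by
      ext ω
      simp only [Set.mem_ofPred_eq, Real.exp_le_exp]
      rw [div_le_div_iff₀ two_pos (by positivity)]
      constructor <;> intro h <;> linarith
    have hmarkov := mul_meas_ge_le_integral_of_nonneg
      (.of_forall fun ω => (Real.exp_pos (|Real.log (f (X ω)) - m| / (2 * Real.sqrt n))).le)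
      hEi (Real.exp (t / 2))
    rw [← hset] at hmarkov
    -- Markov gives `2 exp (1/2 - t/2)`, which is at most `2 exp (-t/16)` exactly when `t ≥ 8/7`.
    -- For smaller `t` the claimed bound exceeds 1.
    rcases le_total t (8 / 7) with h | h
    · refine measureReal_le_one.trans ?_
      have := Real.add_one_le_exp (-(1 / 16) * t)
      linarith
    · have h1 : P.real {ω | t * Real.sqrt n ≤ |Real.log (f (X ω)) - m|} ≤
          2 * Real.exp (1 / 2) / Real.exp (t / 2) := by
        rw [le_div_iff₀ (Real.exp_pos _), mul_comm]
        exact hmarkov.trans hEb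
      refine h1.trans ?_
      rw [mul_div_assoc, ← Real.exp_sub]
      gcongr
      linarith
  · refine iInf_le_of_le (4 * Real.sqrt n) (iInf_le_of_le (by positivity) (iInf_le_of_le ?_ le_rfl))
    have hle : ∀ ω, psiOne ((informationContent X f ω - differentialEntropy f) /
        (4 * Real.sqrt n)) ≤
        Real.exp (|Real.log (f (X ω)) - m| / (2 * Real.sqrt n)) / 4 := by
      intro ω
      rw [psiOne, abs_div, habs, abs_of_pos (by positivity : 0 < 4 * Real.sqrt n)]
      have hsq : Real.exp (|Real.log (f (X ω)) - m| / (2 * Real.sqrt n)) =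
          Real.exp (|Real.log (f (X ω)) - m| / (4 * Real.sqrt n)) ^ 2 := by
        rw [← Real.exp_nat_mul]
        congr 1
        push_cast
        field_simp
        norm_num
      rw [hsq]
      -- With `u = exp (|·| / (4 √n))`, this is `u - 1 ≤ u ^ 2 / 4`. The expectation is then at most
      -- `exp (1/2) / 2 ≤ 1`.
      nlinarith [sq_nonneg (Real.exp (|Real.log (f (X ω)) - m| / (4 * Real.sqrt n)) - 2)]
    calc _ ≤ ∫⁻ ω, ENNReal.ofReal
          (Real.exp (|Real.log (f (X ω)) - m| / (2 * Real.sqrt n)) / 4) ∂P :=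
          lintegral_mono fun ω => ENNReal.ofReal_le_ofReal (hle ω)
      _ = ENNReal.ofReal (∫ ω,
          Real.exp (|Real.log (f (X ω)) - m| / (2 * Real.sqrt n)) / 4 ∂P) :=
          (ofReal_integral_eq_lintegral_ofReal (hEi.div_const 4)
            (.of_forall fun ω => by positivity)).symm
      _ ≤ 1 := by
          rw [integral_div, ENNReal.ofReal_le_one]
          linarith
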